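/- All rings are commutative with $1$. Let $R$ be a ring and $S\subseteq R$ a multiplicative subset ($1\in S$ and $SS\subseteq S$). A sequence of $R$-modules $M\xrightarrow{f}N\xrightarrow{g}L$ is called $S$-exact (at $N$) if there is $s\in S$ with $s\,\mathrm{Ker}(g)\subseteq \mathrm{Im}(f)$ and $s\,\mathrm{Im}(f)\subseteq\mathrm{Ker}(g)$; a longer sequence is $S$-exact if it is $S$-exact at each of its inner terms. An $R$-module $F$ is $S$-flat if for every $S$-exact sequence $0\to M\to N\to L\to 0$ of $R$-modules the induced sequence $0\to M\otimes_R F\to N\otimes_R F\to L\otimes_R F\to 0$ is $S$-exact. The $S$-flat dimension of an $R$-module $M$ is the least $n\geq 0$ for which there is an $S$-exact sequence $0\to F_n\to\cdots\to F_1\to F_0\to M\to 0$ with all $F_i$ $S$-flat (and $\infty$ if there is none), and $S\text{-w.gl.dim}(R)$ is the supremum of the $S$-flat dimensions of all $R$-modules. The flat dimension of $M$ and $\mathrm{w.gl.dim}(R)$ are defined in the same way with exact sequences and flat modules. Let $A$ be a commutative ring with $\mathrm{w.gl.dim}(A)=1$, let $T=A\times A$, $s=(1,0)\in T$ and $R=T[x]/\langle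 sx,\,x^2\rangle$, and let $S=\{1,s\}\subseteq R$ (a multiplicative subset, since $s^2=s$). Then $S\text{-w.gl.dim}(R)=1$, while $\mathrm{w.gl.dim}(R)=\infty$. -/

import Mathlib

open scoped TensorProduct Polynomial

universe u

section SHomological

variable {R : Type u} [CommRing R] (S : Submonoid R)

/-- The sequence `M → N → L` is `S`-exact (at `N`): a single `s ∈ S` satisfies
`s Ker(g) ⊆ Im(f)` and `s Im(f) ⊆ Ker(g)`. -/
def SExact {M N L : Type u} [AddCommGroup M] [Module R M] [AddCommGroup N] [Module R N]
    [AddCommGroup L] [Module R L] (f : M →ₗ[R] N) (g : N →ₗ[R] L) : Prop :=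
  ∃ s ∈ S, (∀ x ∈ LinearMap.ker g, s • x ∈ LinearMap.range f) ∧
    (∀ x ∈ LinearMap.range f, s • x ∈ LinearMap.ker g)

/-- The sequence `0 → M → N → L → 0` is `S`-exact at `M`, `N` and `L`. -/
def ShortSExact {M N L : Type u} [AddCommGroup M] [Module R M] [AddCommGroup N] [Module R N]
    [AddCommGroup L] [Module R L] (f : M →ₗ[R] N) (g : N →ₗ[R] L) : Prop :=
  SExact S (0 : PUnit.{u + 1} →ₗ[R] M) f ∧ SExact S f g ∧ SExact S g (0 : L →ₗ[R] PUnit.{u + 1})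

/-- `F` is `S`-flat: tensoring with `F` preserves short `S`-exact sequences. -/
def SFlat (F : Type u) [AddCommGroup F] [Module R F] : Prop :=
  ∀ (M N L : Type u) [AddCommGroup M] [Module R M] [AddCommGroup N] [Module R N]
    [AddCommGroup L] [Module R L] (f : M →ₗ[R] N) (g : N →ₗ[R] L),
    ShortSExact S f g → ShortSExact S (f.rTensor F) (g.rTensor F)

/-- There is an `S`-exact sequence `0 → F n → ⋯ → F 1 → F 0 → M → 0` with every `F i` `S`-flat.
The sequence is written as an infinite one whose terms beyond `F n` are zero. -/
def HasSFlatSResolution (M : Type u) [AddCommGroup M] [Module R M] (n : ℕ) : Prop :=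
  ∃ (F : ℕ → ModuleCat.{u} R) (d : ∀ i, F (i + 1) →ₗ[R] F i) (ε : F 0 →ₗ[R] M),
    (∀ i ≤ n, SFlat S (F i)) ∧ (∀ i, n < i → Subsingleton (F i)) ∧
    SExact S ε (0 : M →ₗ[R] PUnit.{u + 1}) ∧ SExact S (d 0) ε ∧
    ∀ i, SExact S (d (i + 1)) (d i)

/-- `S`-fd: the length of the shortest `S`-flat `S`-resolution (`⊤` if there is none). -/
noncomputable def sFlatDim (M : Type u) [AddCommGroup M] [Module R M] : ℕ∞ :=
  ⨅ (n : ℕ) (_ : HasSFlatSResolution S M n), (n : ℕ∞)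

/-- `S`-w.gl.dim: the supremum of the `S`-flat dimensions of all `R`-modules. -/
noncomputable def sWeakGlobalDim : ℕ∞ :=
  ⨆ M : ModuleCat.{u} R, sFlatDim S M

end SHomological

section Homological

variable (R : Type u) [CommRing R]

/-- There is an exact sequence `0 → F n → ⋯ → F 1 → F 0 → M → 0` with every `F i` flat.
The sequence is written as an infinite one whose terms beyond `F n` are zero. -/
def HasFlatResolution (M : Type u) [AddCommGroup M] [Module R M] (n : ℕ) : Prop :=
  ∃ (F : ℕ → ModuleCat.{u} R) (d : ∀ i, F (i + 1) →ₗ[R] F i) (ε : F 0 →ₗ[R] M),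
    (∀ i ≤ n, Module.Flat R (F i)) ∧ (∀ i, n < i → Subsingleton (F i)) ∧
    Function.Surjective ε ∧ Function.Exact (d 0) ε ∧
    ∀ i, Function.Exact (d (i + 1)) (d i)

/-- fd: the length of the shortest flat resolution (`⊤` if there is no finite one). -/
noncomputable def flatDim (M : Type u) [AddCommGroup M] [Module R M] : ℕ∞ :=
  ⨅ (n : ℕ) (_ : HasFlatResolution R M n), (n : ℕ∞)

/-- w.gl.dim: the supremum of the flat dimensions of all `R`-modules. -/
noncomputable def weakGlobalDim : ℕ∞ :=
  ⨆ M : ModuleCat.{u} R, flatDim R M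

end Homological

section Construction

variable (A : Type u) [CommRing A]

/-- The ring `R = T[x] / ⟨s x, x²⟩` with `T = A × A` and `s = (1, 0)`. -/
abbrev TruncatedRing : Type u :=
  (A × A)[X] ⧸
    Ideal.span {Polynomial.C ((1, 0) : A × A) * Polynomial.X, (Polynomial.X ^ 2 : (A × A)[X])}

/-- The image in `R` of `s = (1, 0) ∈ T`. -/
noncomputable def truncatedS : TruncatedRing A :=
  Ideal.Quotient.mk _ (Polynomial.C ((1, 0) : A × A))

theorem truncatedS_mul_self : truncatedS A * truncatedS A = truncatedS A := by
  unfold truncatedS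
  rw [← map_mul, ← map_mul]
  simp

/-- The multiplicative subset `S = {1, s}` of `R`. -/
noncomputable def truncatedSubmonoid : Submonoid (TruncatedRing A) where
  carrier := {1, truncatedS A}
  one_mem' := Or.inl rfl
  mul_mem' := by
    rintro a b (rfl | rfl) (rfl | rfl)
    · left; simp
    · right; simp
    · right; simp
    · right; exact truncatedS_mul_self A

end Construction

/-!
When some element of `S` is a multiple of all the others, a module and its localization at `S` are
linked by a map that is bijective up to `S`-torsion, so the `S`-weak global dimension of `R` is the
weak global dimension of the localization. For `R = T[x]/⟨sx, x²⟩` and `S = {1, s}`, inverting the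
idempotent `s` kills `x` and the second factor of `T`, leaving `A`.

On the other hand, each of `x` and `s + x` generates the annihilator of the other. The resulting
periodic exact sequence remains exact after tensoring with a flat module, hence, by induction along
syzygies, with any module of finite flat dimension. It does not remain exact for
`R/⟨x, s + x⟩ ≅ A`, on which both elements act as zero.
-/

section SExactness

variable {R : Type u} [CommRing R] {S : Submonoid R}
  {M N L : Type u} [AddCommGroup M] [Module R M] [AddCommGroup N] [Module R N]
  [AddCommGroup L] [Module R L]

theorem sExact_zero_left_iff {P : Type u} [AddCommGroup P] [Module R P] {f : M →ₗ[R] N} :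
    SExact S (0 : P →ₗ[R] M) f ↔ ∃ s ∈ S, ∀ x, f x = 0 → s • x = 0 := by
  simp [SExact, LinearMap.range_zero]

theorem sExact_zero_right_iff {P : Type u} [AddCommGroup P] [Module R P] {f : M →ₗ[R] N} :
    SExact S f (0 : N →ₗ[R] P) ↔ ∃ s ∈ S, ∀ x, s • x ∈ LinearMap.range f := by
  simp [SExact]

theorem sExact_of_exact {f : M →ₗ[R] N} {g : N →ₗ[R] L} (h : Function.Exact f g) :
    SExact S f g :=
  ⟨1, S.one_mem, fun x hx ↦ by simpa using (h x).1 hx, fun x hx ↦ by simpa using (h x).2 hx⟩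

theorem shortSExact_of_exact {f : M →ₗ[R] N} {g : N →ₗ[R] L} (hf : Function.Injective f)
    (hfg : Function.Exact f g) (hg : Function.Surjective g) : ShortSExact S f g :=
  ⟨sExact_of_exact ((LinearMap.exact_zero_iff_injective _ f).2 hf), sExact_of_exact hfg,
    sExact_of_exact ((LinearMap.exact_zero_iff_surjective _ g).2 hg)⟩

theorem SExact.rTensor {f : M →ₗ[R] N} {g : N →ₗ[R] L} (h : SExact S f g)
    (F : Type u) [AddCommGroup F] [Module R F] [Module.Flat R F] :
    SExact S (f.rTensor F) (g.rTensor F) := by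
  obtain ⟨s, hs, hker, hrange⟩ := h
  refine ⟨s, hs, fun x hx ↦ ?_, ?_⟩
  · -- By flatness the kernel of `g ⊗ F` is generated by the tensors `k ⊗ c` with `g k = 0`.
    obtain ⟨y, rfl⟩ :=
      (Module.Flat.rTensor_exact F (LinearMap.exact_subtype_ker_map g) x).1 hx
    clear hx
    induction y with
    | zero => simp
    | add a b ha hb => simpa only [map_add, smul_add] using add_mem ha hb
    | tmul k c =>
      obtain ⟨m, hm⟩ := hker k k.2
      exact ⟨m ⊗ₜ c, by simp [hm, TensorProduct.smul_tmul']⟩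
  · rintro _ ⟨y, rfl⟩
    have hcomp : s • (g ∘ₗ f) = 0 := LinearMap.ext fun m ↦ by simpa using hrange (f m) ⟨m, rfl⟩
    have hcompF : s • (g.rTensor F ∘ₗ f.rTensor F) = 0 := by
      rw [← LinearMap.rTensor_comp, ← LinearMap.rTensor_smul, hcomp, LinearMap.rTensor_zero]
    simpa using LinearMap.congr_fun hcompF y

theorem sFlat_of_flat (F : Type u) [AddCommGroup F] [Module R F] [Module.Flat R F] :
    SFlat S F := by
  rintro M N L _ _ _ _ _ _ f g ⟨hf, hfg, hg⟩
  have hfF := hf.rTensor F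
  have hgF := hg.rTensor F
  rw [LinearMap.rTensor_zero] at hfF hgF
  exact ⟨sExact_zero_left_iff.2 (sExact_zero_left_iff.1 hfF), hfg.rTensor F,
    sExact_zero_right_iff.2 (sExact_zero_right_iff.1 hgF)⟩

end SExactness

section Resolutions

variable {R : Type u} [CommRing R] {M N : Type u} [AddCommGroup M] [Module R M]
  [AddCommGroup N] [Module R N] {n : ℕ}

theorem hasFlatResolution_zero_iff : HasFlatResolution R M 0 ↔ Module.Flat R M := by
  constructor
  · rintro ⟨F, d, ε, hF, hF', hε, hd, -⟩
    have := hF 0 le_rfl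
    have := hF' 1 one_pos
    have hinj : Function.Injective ε := by
      rw [Subsingleton.elim (d 0) 0] at hd
      exact (LinearMap.exact_zero_iff_injective _ ε).1 hd
    exact Module.Flat.of_linearEquiv (LinearEquiv.ofBijective ε ⟨hinj, hε⟩).symm
  · intro hM
    refine ⟨fun i ↦ Nat.casesOn i (ModuleCat.of R M) fun _ ↦ ModuleCat.of R PUnit, fun _ ↦ 0,
      LinearMap.id, ?_, ?_, Function.surjective_id,
      (LinearMap.exact_zero_iff_injective _ _).2 Function.injective_id, fun i x ↦ ?_⟩
    · rintro i hi
      obtain rfl : i = 0 := Nat.le_zero.1 hi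
      exact hM
    · rintro (_ | i) hi
      · exact absurd hi (lt_irrefl 0)
      · exact inferInstanceAs (Subsingleton PUnit)
    · exact ⟨fun _ ↦ ⟨0, rfl⟩, fun _ ↦ rfl⟩

theorem HasFlatResolution.exists_syzygy (h : HasFlatResolution R M (n + 1)) :
    ∃ (F : ModuleCat.{u} R) (p : F →ₗ[R] M), Module.Flat R F ∧ Function.Surjective p ∧
      HasFlatResolution R (LinearMap.ker p) n := by
  obtain ⟨F, d, ε, hF, hF', hε, hd, hd'⟩ := h
  refine ⟨F 0, ε, hF 0 (Nat.zero_le _), hε, fun i ↦ F (i + 1), fun i ↦ d (i + 1),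
    (d 0).codRestrict _ hd.apply_apply_eq_zero, fun i hi ↦ hF _ (Nat.succ_le_succ hi),
    fun i hi ↦ hF' _ (Nat.succ_lt_succ hi), ?_, fun x ↦ ?_, fun i ↦ hd' (i + 1)⟩
  · rintro ⟨x, hx⟩
    obtain ⟨y, rfl⟩ := (hd x).1 hx
    exact ⟨y, rfl⟩
  · rw [← Subtype.coe_inj]
    exact hd' 0 x

theorem HasFlatResolution.of_linearEquiv (h : HasFlatResolution R M n) (e : M ≃ₗ[R] N) :
    HasFlatResolution R N n := by
  obtain ⟨F, d, ε, hF, hF', hε, hd, hd'⟩ := h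
  refine ⟨F, d, e ∘ₗ ε, hF, hF', e.surjective.comp hε, fun x ↦ ?_, hd'⟩
  rw [← hd x]
  exact e.map_eq_zero_iff

theorem HasFlatResolution.restrictScalars {A : Type u} [CommRing A] [Algebra R A]
    [Module.Flat R A] [Module A M] [IsScalarTower R A M] (h : HasFlatResolution A M n) :
    HasFlatResolution R M n := by
  obtain ⟨F, d, ε, hF, hF', hε, hd, hd'⟩ := h
  let (i : ℕ) : Module R (F i) := Module.compHom (F i) (algebraMap R A)
  have (i : ℕ) : IsScalarTower R A (F i) := IsScalarTower.of_algebraMap_smul fun _ _ ↦ rfl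
  refine ⟨fun i ↦ ModuleCat.of R (F i), fun i ↦ (d i).restrictScalars R, ε.restrictScalars R,
    fun i hi ↦ ?_, hF', hε, hd, hd'⟩
  have := hF i hi
  exact Module.Flat.trans R A (F i)

variable {S : Submonoid R}

theorem HasFlatResolution.hasSFlatSResolution (h : HasFlatResolution R M n) :
    HasSFlatSResolution S M n := by
  obtain ⟨F, d, ε, hF, hF', hε, hd, hd'⟩ := h
  refine ⟨F, d, ε, fun i hi ↦ ?_, hF',
    sExact_of_exact ((LinearMap.exact_zero_iff_surjective _ ε).2 hε),
    sExact_of_exact hd, fun i ↦ sExact_of_exact (hd' i)⟩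
  have := hF i hi
  exact sFlat_of_flat (F i)

theorem HasSFlatSResolution.of_sInjective_of_sSurjective (h : HasSFlatSResolution S M n)
    (j : M →ₗ[R] N) (hinj : SExact S (0 : PUnit.{u + 1} →ₗ[R] M) j)
    (hsurj : SExact S j (0 : N →ₗ[R] PUnit.{u + 1})) : HasSFlatSResolution S N n := by
  obtain ⟨F, d, ε, hF, hF', hε, ⟨t, ht, htker, htrange⟩, hd'⟩ := h
  obtain ⟨r, hr, hrj⟩ := sExact_zero_left_iff.1 hinj
  obtain ⟨q, hq, hqj⟩ := sExact_zero_right_iff.1 hsurj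
  obtain ⟨s, hs, hsε⟩ := sExact_zero_right_iff.1 hε
  refine ⟨F, d, j ∘ₗ ε, hF, hF', sExact_zero_right_iff.2 ⟨s * q, S.mul_mem hs hq, fun x ↦ ?_⟩,
    ⟨t * r, S.mul_mem ht hr, fun x hx ↦ ?_, fun x hx ↦ ?_⟩, hd'⟩
  · obtain ⟨m, hm⟩ := hqj x
    obtain ⟨y, hy⟩ := hsε m
    exact ⟨y, by rw [LinearMap.comp_apply, hy, map_smul, hm, mul_smul]⟩
  · rw [mul_smul]
    exact htker _ (by simpa using hrj (ε x) hx)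
  · have hε₀ : ε (t • x) = 0 := htrange x hx
    rw [mul_comm, mul_smul, LinearMap.mem_ker, map_smul, LinearMap.comp_apply, hε₀, map_zero,
      smul_zero]

end Resolutions

/-- The maximal multiple condition on a multiplicative subset: some element of `S` is a multiple
of every element of `S`. It makes statements of the form "for each `x` there is `s ∈ S`" uniform
in `x`, so that `S`-homological notions are determined by the localization at `S`. -/
def HasMaximalMultiple {R : Type*} [CommMonoid R] (S : Submonoid R) : Prop :=
  ∃ s ∈ S, ∀ t ∈ S, t ∣ s

section Localization

variable {R : Type u} [CommRing R] {S : Submonoid R} (A : Type u) [CommRing A] [Algebra R A]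
  [IsLocalization S A]

theorem SExact.baseChange_exact {M N L : Type u} [AddCommGroup M] [Module R M] [AddCommGroup N]
    [Module R N] [AddCommGroup L] [Module R L] {f : M →ₗ[R] N} {g : N →ₗ[R] L}
    (h : SExact S f g) : Function.Exact (f.baseChange A) (g.baseChange A) := by
  obtain ⟨s, hs, hker, hrange⟩ := h
  have isUnit_of_mem {r : R} (hr : r ∈ S) : IsUnit (algebraMap R A r) :=
    IsLocalization.map_units A ⟨r, hr⟩
  refine fun x ↦ ⟨fun hx ↦ ?_, ?_⟩
  · obtain ⟨⟨n, t⟩, hn⟩ := IsLocalizedModule.surj S (TensorProduct.mk R A N 1) x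
    have hgn : TensorProduct.mk R A L 1 (g n) = 0 := by
      have := congrArg (g.baseChange A) hn
      simpa [Submonoid.smul_def, hx] using this.symm
    obtain ⟨u, hu⟩ := (IsLocalizedModule.eq_zero_iff S _).1 hgn
    obtain ⟨m, hm⟩ := hker (u • n) (by simpa [Submonoid.smul_def] using hu)
    obtain ⟨v, hv⟩ := isUnit_of_mem (S.mul_mem (S.mul_mem hs u.2) t.2)
    refine ⟨(↑v⁻¹ : A) ⊗ₜ m, ?_⟩
    have hvx : (v : A) • x = (1 : A) ⊗ₜ[R] f m := by
      rw [hv, algebraMap_smul, hm, mul_smul, mul_smul, Submonoid.smul_def, TensorProduct.tmul_smul,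
        TensorProduct.tmul_smul]
      exact congrArg (fun w ↦ s • (u : R) • w) hn
    calc f.baseChange A ((↑v⁻¹ : A) ⊗ₜ m) = (↑v⁻¹ : A) • ((1 : A) ⊗ₜ[R] f m) := by
          rw [LinearMap.baseChange_tmul, TensorProduct.smul_tmul', smul_eq_mul, mul_one]
      _ = x := by rw [← hvx, smul_smul, v.inv_mul, one_smul]
  · rintro ⟨y, rfl⟩
    have hcomp : s • (g ∘ₗ f) = 0 := LinearMap.ext fun m ↦ by simpa using hrange (f m) ⟨m, rfl⟩
    have hcompA : s • (g.baseChange A ∘ₗ f.baseChange A) = 0 := by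
      rw [← LinearMap.baseChange_comp, ← LinearMap.baseChange_smul, hcomp,
        LinearMap.baseChange_zero]
    rw [← (isUnit_of_mem hs).smul_eq_zero, algebraMap_smul]
    exact LinearMap.congr_fun hcompA y

theorem SFlat.flat_baseChange {F : Type u} [AddCommGroup F] [Module R F] (hF : SFlat S F) :
    Module.Flat A (A ⊗[R] F) := by
  refine Module.Flat.iff_rTensor_injective'.2 fun I ↦ ?_
  let i : I →ₗ[R] A := I.subtype.restrictScalars R
  have hi : ShortSExact S i (LinearMap.range i).mkQ :=
    shortSExact_of_exact I.injective_subtype (LinearMap.exact_map_mkQ_range i)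
      (Submodule.mkQ_surjective _)
  have hiF : Function.Injective (i.rTensor F) := by
    obtain ⟨s, hs, hsker⟩ := sExact_zero_left_iff.1 (hF _ _ _ i _ hi).1
    refine (injective_iff_map_eq_zero _).2 fun x hx ↦ ?_
    rw [← (IsLocalization.map_units A ⟨s, hs⟩).smul_eq_zero, algebraMap_smul]
    exact hsker x hx
  have hcancel : TensorProduct.AlgebraTensorModule.rTensor R F I.subtype ∘ₗ
        (TensorProduct.AlgebraTensorModule.cancelBaseChange R A A I F).toLinearMap =
      (TensorProduct.AlgebraTensorModule.cancelBaseChange R A A A F).toLinearMap ∘ₗ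
        I.subtype.rTensor (A ⊗[R] F) := by
    ext
    simp
  have hcomp : Function.Injective (TensorProduct.AlgebraTensorModule.rTensor R F I.subtype ∘
      TensorProduct.AlgebraTensorModule.cancelBaseChange R A A I F) :=
    hiF.comp (LinearEquiv.injective _)
  exact .of_comp (f := TensorProduct.AlgebraTensorModule.cancelBaseChange R A A A F)
    (by rwa [← LinearEquiv.coe_coe, ← LinearMap.coe_comp, hcancel, LinearMap.coe_comp] at hcomp)

theorem HasSFlatSResolution.baseChange {M : Type u} [AddCommGroup M] [Module R M] {n : ℕ}
    (h : HasSFlatSResolution S M n) : HasFlatResolution A (A ⊗[R] M) n := by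
  obtain ⟨F, d, ε, hF, hF', hε, hd, hd'⟩ := h
  have hεA := hε.baseChange_exact A
  rw [LinearMap.baseChange_zero, LinearMap.exact_zero_iff_surjective] at hεA
  refine ⟨fun i ↦ ModuleCat.of A (A ⊗[R] F i), fun i ↦ (d i).baseChange A, ε.baseChange A,
    fun i hi ↦ (hF i hi).flat_baseChange A, fun i hi ↦ ?_, hεA, hd.baseChange_exact A,
    fun i ↦ (hd' i).baseChange_exact A⟩
  have := hF' i hi
  exact inferInstanceAs (Subsingleton (A ⊗[R] F i))

variable (S) in
theorem flatDim_le_sFlatDim (N : Type u) [AddCommGroup N] [Module R N] [Module A N]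
    [IsScalarTower R A N] : flatDim A N ≤ sFlatDim S N :=
  le_iInf₂ fun n h ↦
    iInf₂_le n ((h.baseChange A).of_linearEquiv (IsLocalization.moduleLid S A N))

variable (S) in
theorem weakGlobalDim_le_sWeakGlobalDim : weakGlobalDim A ≤ sWeakGlobalDim S := by
  refine iSup_le fun N ↦ ?_
  let : Module R N := Module.compHom N (algebraMap R A)
  have : IsScalarTower R A N := IsScalarTower.of_algebraMap_smul fun _ _ ↦ rfl
  exact (flatDim_le_sFlatDim S A N).trans
    (le_iSup (fun M : ModuleCat.{u} R ↦ sFlatDim S M) (ModuleCat.of R N))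

-- The map sends `m / t` to `(s² / t) m`, where `s` is a maximal multiple.
theorem HasMaximalMultiple.exists_sInjective_sSurjective (hS : HasMaximalMultiple S)
    {M M' : Type u} [AddCommGroup M] [Module R M] [AddCommGroup M'] [Module R M']
    (u : M →ₗ[R] M') [IsLocalizedModule S u] :
    ∃ j : M' →ₗ[R] M, SExact S (0 : PUnit.{u + 1} →ₗ[R] M') j ∧
      SExact S j (0 : M →ₗ[R] PUnit.{u + 1}) := by
  obtain ⟨s, hs, hdvd⟩ := hS
  have hker : LinearMap.ker u ≤ LinearMap.ker (LinearMap.lsmul R M s) := fun m hm ↦ by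
    obtain ⟨t, ht⟩ := (IsLocalizedModule.eq_zero_iff S u).1 hm
    obtain ⟨c, rfl⟩ := hdvd t t.2
    rw [LinearMap.mem_ker, LinearMap.lsmul_apply, mul_comm, mul_smul, ← Submonoid.smul_def, ht,
      smul_zero]
  have hrange (x : M') : LinearMap.lsmul R M' s x ∈ LinearMap.range u := by
    obtain ⟨⟨m, t⟩, hm⟩ := IsLocalizedModule.surj S u x
    obtain ⟨c, rfl⟩ := hdvd t t.2
    refine ⟨c • m, ?_⟩
    rw [map_smul, ← hm, LinearMap.lsmul_apply, mul_comm, mul_smul, Submonoid.smul_def]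
  let j : M' →ₗ[R] M := (LinearMap.ker u).liftQ _ hker ∘ₗ u.quotKerEquivRange.symm ∘ₗ
    (LinearMap.lsmul R M' s).codRestrict (LinearMap.range u) hrange
  have hj {x : M'} {m : M} (h : u m = s • x) : j x = s • m := by
    have : (LinearMap.lsmul R M' s).codRestrict (LinearMap.range u) hrange x =
      u.quotKerEquivRange (Submodule.Quotient.mk m) := Subtype.ext h.symm
    simp [j, this]
  refine ⟨j, sExact_zero_left_iff.2 ⟨s * s, S.mul_mem hs hs, fun x hx ↦ ?_⟩,
    sExact_zero_right_iff.2 ⟨s * s, S.mul_mem hs hs, fun m ↦ ⟨u m, ?_⟩⟩⟩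
  · obtain ⟨m, hm⟩ := hrange x
    rw [LinearMap.lsmul_apply] at hm
    rw [mul_smul, ← hm, ← map_smul, ← hj hm, hx, map_zero]
  · rw [hj (map_smul u s m), mul_smul]

theorem HasMaximalMultiple.sFlatDim_le_flatDim_baseChange (hS : HasMaximalMultiple S)
    (M : Type u) [AddCommGroup M] [Module R M] : sFlatDim S M ≤ flatDim A (A ⊗[R] M) := by
  have : Module.Flat R A := IsLocalization.flat A S
  obtain ⟨j, hinj, hsurj⟩ := hS.exists_sInjective_sSurjective (TensorProduct.mk R A M 1)
  exact le_iInf₂ fun n h ↦ iInf₂_le n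
    (h.restrictScalars.hasSFlatSResolution.of_sInjective_of_sSurjective j hinj hsurj)

theorem HasMaximalMultiple.sWeakGlobalDim_eq (hS : HasMaximalMultiple S) :
    sWeakGlobalDim S = weakGlobalDim A :=
  le_antisymm
    (iSup_le fun M ↦ (hS.sFlatDim_le_flatDim_baseChange A M).trans
      (le_iSup (fun N : ModuleCat.{u} A ↦ flatDim A N) (ModuleCat.of A (A ⊗[R] M))))
    (weakGlobalDim_le_sWeakGlobalDim S A)

end Localization

/-- `y` and `z` form an exact pair on `M`: the periodic sequence of multiplications
`⋯ → M → M → M → ⋯` by `y` and `z` alternately is exact. On `M = R` this says that `y` and `z` are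
an exact pair of zero divisors, that is, each generates the annihilator of the other. -/
structure IsExactPair {R : Type*} [CommRing R] (y z : R) (M : Type*) [AddCommGroup M]
    [Module R M] : Prop where
  exact_left : Function.Exact (fun m : M ↦ y • m) (fun m : M ↦ z • m)
  exact_right : Function.Exact (fun m : M ↦ z • m) (fun m : M ↦ y • m)

section ExactPair

theorem exact_smul_of_flat {R : Type*} [CommRing R] {y z : R}
    (h : Function.Exact (fun r : R ↦ y • r) (fun r : R ↦ z • r))
    (F : Type*) [AddCommGroup F] [Module R F] [Module.Flat R F] :
    Function.Exact (fun m : F ↦ y • m) (fun m : F ↦ z • m) := by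
  have hR : Function.Exact (LinearMap.lsmul R R y) (LinearMap.lsmul R R z) := h
  have hladder (r : R) : LinearMap.lsmul R F r ∘ₗ (TensorProduct.rid R F).toLinearMap =
      (TensorProduct.rid R F).toLinearMap ∘ₗ (LinearMap.lsmul R R r).lTensor F := by
    ext
    simp
  exact (Function.Exact.iff_of_ladder_linearEquiv (hladder y) (hladder z)).2
    (Module.Flat.lTensor_exact F hR)

theorem exact_smul_of_shortExact {R K F M : Type*} [CommRing R] [AddCommGroup K] [Module R K]
    [AddCommGroup F] [Module R F] [AddCommGroup M] [Module R M] {y z : R}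
    {i : K →ₗ[R] F} {p : F →ₗ[R] M} (hi : Function.Injective i) (hip : Function.Exact i p)
    (hp : Function.Surjective p) (hK : Function.Exact (fun k : K ↦ z • k) (fun k : K ↦ y • k))
    (hF : IsExactPair y z F) :
    Function.Exact (fun m : M ↦ y • m) (fun m : M ↦ z • m) := by
  refine fun m ↦ ⟨fun hm ↦ ?_, ?_⟩
  · obtain ⟨x, rfl⟩ := hp m
    obtain ⟨k, hk⟩ := (hip (z • x)).1 (by rw [map_smul]; exact hm)
    have hyk : y • k = 0 := hi <| by
      rw [map_smul, hk, map_zero]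
      exact hF.exact_right.apply_apply_eq_zero x
    obtain ⟨k', rfl : z • k' = k⟩ := (hK k).1 hyk
    have hz : z • (x - i k') = 0 := by rw [smul_sub, ← hk, map_smul, sub_self]
    obtain ⟨w, hw : y • w = x - i k'⟩ := (hF.exact_left _).1 hz
    have hpw : y • p w = p x := by
      rw [← map_smul, hw, map_sub, hip.apply_apply_eq_zero, sub_zero]
    exact ⟨p w, hpw⟩
  · rintro ⟨m', rfl⟩
    obtain ⟨x, rfl⟩ := hp m'
    have := congrArg p (hF.exact_left.apply_apply_eq_zero x)
    simpa only [map_smul, map_zero] using this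

namespace IsExactPair

theorem symm {R M : Type*} [CommRing R] [AddCommGroup M] [Module R M] {y z : R}
    (h : IsExactPair y z M) : IsExactPair z y M :=
  ⟨h.exact_right, h.exact_left⟩

theorem of_flat {R : Type*} [CommRing R] {y z : R} (h : IsExactPair y z R) (F : Type*)
    [AddCommGroup F] [Module R F] [Module.Flat R F] : IsExactPair y z F :=
  ⟨exact_smul_of_flat h.exact_left F, exact_smul_of_flat h.exact_right F⟩

theorem of_shortExact {R K F M : Type*} [CommRing R] [AddCommGroup K] [Module R K]
    [AddCommGroup F] [Module R F] [AddCommGroup M] [Module R M] {y z : R}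
    {i : K →ₗ[R] F} {p : F →ₗ[R] M} (hi : Function.Injective i) (hip : Function.Exact i p)
    (hp : Function.Surjective p) (hK : IsExactPair y z K) (hF : IsExactPair y z F) :
    IsExactPair y z M :=
  ⟨exact_smul_of_shortExact hi hip hp hK.exact_right hF,
    exact_smul_of_shortExact hi hip hp hK.exact_left hF.symm⟩

variable {R : Type u} [CommRing R] {y z : R}

theorem of_hasFlatResolution (h : IsExactPair y z R) {n : ℕ} :
    ∀ {M : Type u} [AddCommGroup M] [Module R M], HasFlatResolution R M n → IsExactPair y z M := by
  induction n with
  | zero =>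
    intro M _ _ hM
    have := hasFlatResolution_zero_iff.1 hM
    exact h.of_flat M
  | succ n ih =>
    intro M _ _ hM
    obtain ⟨F, p, hF, hp, hK⟩ := hM.exists_syzygy
    exact of_shortExact (Submodule.injective_subtype _) (LinearMap.exact_subtype_ker_map p) hp
      (ih hK) (h.of_flat F)

theorem weakGlobalDim_eq_top (h : IsExactPair y z R) (hne : Ideal.span {y, z} ≠ ⊤) :
    weakGlobalDim R = ⊤ := by
  let M := R ⧸ Ideal.span {y, z}
  have smul_eq_zero_of_mem {r : R} (hr : r ∈ ({y, z} : Set R)) (m : M) : r • m = 0 := by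
    obtain ⟨t, rfl⟩ := Ideal.Quotient.mk_surjective m
    exact Ideal.Quotient.eq_zero_iff_mem.2 (Ideal.mul_mem_right t _ (Ideal.subset_span hr))
  have hM : flatDim R M = ⊤ := by
    refine iInf₂_eq_top.2 fun n hn ↦ ?_
    obtain ⟨m, hm⟩ := ((h.of_hasFlatResolution hn).exact_left (1 : M)).1
      (smul_eq_zero_of_mem (by simp) 1)
    have : (0 : M) = 1 := (smul_eq_zero_of_mem (by simp) m).symm.trans hm
    exact absurd (Ideal.Quotient.zero_eq_one_iff.1 this) hne
  exact top_le_iff.1 (hM ▸ le_iSup (fun M : ModuleCat.{u} R ↦ flatDim R M) (ModuleCat.of R M))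

end IsExactPair

theorem isExactPair_add_of_isIdempotentElem {R : Type*} [CommRing R] {e y : R}
    (he : IsIdempotentElem e) (hey : e * y = 0) (hyy : y * y = 0)
    (hann : ∀ r, y * r = 0 → r ∈ Ideal.span {e, y}) : IsExactPair y (e + y) R := by
  refine ⟨fun r ↦ ⟨fun hr ↦ ?_, ?_⟩, fun r ↦ ⟨fun hr ↦ ?_, ?_⟩⟩
  · have her : e * r = 0 := by linear_combination e * hr - r * hey - r * he.eq
    have hyr : y * r = 0 := by linear_combination hr - her
    obtain ⟨a, b, rfl⟩ := Ideal.mem_span_pair.1 (hann r hyr)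
    exact ⟨b, by linear_combination -her + a * he.eq + b * hey⟩
  · rintro ⟨b, rfl⟩
    linear_combination b * hey + b * hyy
  · obtain ⟨a, b, rfl⟩ := Ideal.mem_span_pair.1 (hann r hr)
    exact ⟨e * a + (1 - e) * b, by
      linear_combination (a - b) * he.eq + (a - b) * hey⟩
  · rintro ⟨b, rfl⟩
    linear_combination b * hey + b * hyy

end ExactPair

section TruncatedRing

variable (A : Type u) [CommRing A]

/-- The evaluation `R → T` at `x = 0`. -/
noncomputable def truncatedEval : TruncatedRing A →+* A × A :=
  Ideal.Quotient.lift _ (Polynomial.evalRingHom 0) fun _ hp ↦ RingHom.mem_ker.1 <|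
    (Ideal.span_le (I := RingHom.ker (Polynomial.evalRingHom (0 : A × A)))).2
      (by rintro _ (rfl | rfl) <;> simp [RingHom.mem_ker]) hp

theorem truncatedEval_mk (p : (A × A)[X]) :
    truncatedEval A (Ideal.Quotient.mk _ p) = p.eval 0 := rfl

/-- The class of the variable `x` in `R`. -/
noncomputable def truncatedX : TruncatedRing A :=
  Ideal.Quotient.mk _ Polynomial.X

theorem truncatedS_mul_truncatedX : truncatedS A * truncatedX A = 0 := by
  rw [truncatedS, truncatedX, ← map_mul, Ideal.Quotient.eq_zero_iff_mem]
  exact Ideal.subset_span (by simp)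

theorem truncatedX_mul_self : truncatedX A * truncatedX A = 0 := by
  rw [truncatedX, ← map_mul, ← sq, Ideal.Quotient.eq_zero_iff_mem]
  exact Ideal.subset_span (by simp)

theorem mem_span_of_truncatedX_mul_eq_zero (r : TruncatedRing A) (h : truncatedX A * r = 0) :
    r ∈ Ideal.span {truncatedS A, truncatedX A} := by
  obtain ⟨p, rfl⟩ := Ideal.Quotient.mk_surjective r
  rw [truncatedX, ← map_mul, Ideal.Quotient.eq_zero_iff_mem, Ideal.mem_span_pair] at h
  obtain ⟨a, b, hab⟩ := h
  have hp : p = a * Polynomial.C (1, 0) + b * Polynomial.X :=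
    Polynomial.isRegular_X.left <| by
      change Polynomial.X * p = Polynomial.X * _
      rw [← hab]
      ring
  exact Ideal.mem_span_pair.2 ⟨Ideal.Quotient.mk _ a, Ideal.Quotient.mk _ b, by
    rw [hp, map_add, map_mul, map_mul, truncatedS, truncatedX]⟩

theorem isExactPair_truncatedX :
    IsExactPair (truncatedX A) (truncatedS A + truncatedX A) (TruncatedRing A) :=
  isExactPair_add_of_isIdempotentElem (truncatedS_mul_self A) (truncatedS_mul_truncatedX A)
    (truncatedX_mul_self A) (mem_span_of_truncatedX_mul_eq_zero A)

theorem span_truncatedX_ne_top [Nontrivial A] :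
    Ideal.span {truncatedX A, truncatedS A + truncatedX A} ≠ ⊤ := by
  have hle : Ideal.span {truncatedX A, truncatedS A + truncatedX A} ≤
      RingHom.ker ((RingHom.snd A A).comp (truncatedEval A)) := by
    rw [Ideal.span_le]
    rintro _ (rfl | rfl) <;>
      simp [RingHom.mem_ker, truncatedS, truncatedX, truncatedEval_mk]
  exact fun h ↦ RingHom.ker_ne_top _ (top_le_iff.1 (h ▸ hle))

theorem weakGlobalDim_truncatedRing [Nontrivial A] : weakGlobalDim (TruncatedRing A) = ⊤ :=
  (isExactPair_truncatedX A).weakGlobalDim_eq_top (span_truncatedX_ne_top A)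

theorem truncatedSubmonoid_eq_powers :
    truncatedSubmonoid A = Submonoid.powers (truncatedS A) :=
  SetLike.coe_injective (IsIdempotentElem.coe_powers (truncatedS_mul_self A)).symm

theorem hasMaximalMultiple_truncatedSubmonoid :
    HasMaximalMultiple (R := TruncatedRing A) (truncatedSubmonoid A) :=
  ⟨truncatedS A, Or.inr rfl, by
    rintro t (rfl | rfl)
    · exact one_dvd _
    · exact dvd_rfl⟩

theorem truncatedS_mul_eq_truncatedEval (r : TruncatedRing A) :
    truncatedS A * r = Ideal.Quotient.mk _ (Polynomial.C ((truncatedEval A r).1, 0)) := by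
  obtain ⟨p, rfl⟩ := Ideal.Quotient.mk_surjective r
  rw [truncatedEval_mk, truncatedS, ← map_mul, Ideal.Quotient.eq, Ideal.mem_span_pair]
  refine ⟨p.divX, 0, ?_⟩
  have hp : p.divX * Polynomial.X + Polynomial.C (p.eval 0) = p := by
    rw [← Polynomial.coeff_zero_eq_eval_zero, Polynomial.divX_mul_X_add]
  have hC : (Polynomial.C ((p.eval 0).1, 0) : (A × A)[X]) =
      Polynomial.C (1, 0) * Polynomial.C (p.eval 0) := by
    rw [← Polynomial.C_mul]
    congr 1
    ext <;> simp
  linear_combination Polynomial.C (1, 0) * hp + hC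

/-- The first coordinate of the value at `x = 0`, which exhibits `A` as the localization of `R`
at `S`. -/
@[reducible]
noncomputable def truncatedAlgebra : Algebra (TruncatedRing A) A :=
  ((RingHom.fst A A).comp (truncatedEval A)).toAlgebra

attribute [local instance] truncatedAlgebra

theorem isLocalization_truncatedSubmonoid :
    IsLocalization (R := TruncatedRing A) (truncatedSubmonoid A) A := by
  rw [truncatedSubmonoid_eq_powers]
  refine IsLocalization.away_of_isIdempotentElem_of_mul (truncatedS_mul_self A) (fun r t ↦ ?_)
    fun a ↦ ⟨Ideal.Quotient.mk _ (Polynomial.C (a, 0)), ?_⟩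
  · change (truncatedEval A r).1 = (truncatedEval A t).1 ↔ _
    rw [truncatedS_mul_eq_truncatedEval, truncatedS_mul_eq_truncatedEval]
    refine ⟨fun h ↦ by rw [h], fun h ↦ ?_⟩
    simpa [truncatedEval_mk] using congrArg (truncatedEval A) h
  · change (truncatedEval A (Ideal.Quotient.mk _ (Polynomial.C (a, 0)))).1 = a
    simp [truncatedEval_mk]

theorem sWeakGlobalDim_truncatedSubmonoid :
    sWeakGlobalDim (R := TruncatedRing A) (truncatedSubmonoid A) = weakGlobalDim A :=
  have := isLocalization_truncatedSubmonoid A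
  (hasMaximalMultiple_truncatedSubmonoid A).sWeakGlobalDim_eq A

end TruncatedRing

theorem nontrivial_of_weakGlobalDim_ne_zero {A : Type u} [CommRing A]
    (h : weakGlobalDim A ≠ 0) : Nontrivial A := by
  by_contra hA
  rw [not_nontrivial_iff_subsingleton] at hA
  refine h (nonpos_iff_eq_zero.1 (iSup_le fun M ↦ ?_))
  have : Subsingleton M := Module.subsingleton A M
  exact iInf₂_le 0 (hasFlatResolution_zero_iff.2 inferInstance)

theorem mainTheorem12_general (A : Type*) [CommRing A] [Nontrivial A] :
    sWeakGlobalDim (R := TruncatedRing A) (truncatedSubmonoid A) = weakGlobalDim A ∧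
      weakGlobalDim (TruncatedRing A) = ⊤ :=
  ⟨sWeakGlobalDim_truncatedSubmonoid A, weakGlobalDim_truncatedRing A⟩

theorem mainTheorem12 (A : Type*) [CommRing A] (hA : weakGlobalDim A = 1) :
    sWeakGlobalDim (R := TruncatedRing A) (truncatedSubmonoid A) = 1 ∧ weakGlobalDim (TruncatedRing A) = ⊤ := by
  have : Nontrivial A := nontrivial_of_weakGlobalDim_ne_zero (by simp [hA])
  exact hA ▸ mainTheorem12_general A
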